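/- **Theorem (Consistency and asymptotic normality of score matching).** Fix $t\in[0,T]$. Let $\Theta\subseteq\mathbb{R}^m$ and let $\{p_\theta(t,\cdot)\}_{\theta\in\Theta}$ be continuously differentiable, strictly positive probability densities on $\mathbb{R}^d$. Let $p(t,\cdot)$ be a probability density with full support (i.e. positive everywhere), with $p(t,\cdot)=p_{\theta_*}(t,\cdot)$ for some $\theta_*\in\Theta$ and $p(t,\cdot)\neq p_\theta(t,\cdot)$ for every $\theta\in\Theta$, $\theta\ne\theta_*$. Write $$\mathcal{J}_{\mathrm{ESM}}(\theta):=\mathbb{E}_{X\sim p(t,\cdot)}\,\bigl|\nabla\log p_\theta(t,X)-\nabla\log p(t,X)\bigr|^2\in[0,\infty].$$ (1) For $\theta\in\Theta$, $\mathcal{J}_{\mathrm{ESM}}(\theta)=0$ if and only if $\theta=\theta_*$. (2) Assume further that $p_\theta(t,x)\propto\exp(\theta\cdot F(x))$ for all $\theta\in\Theta$, where $F:\mathbb{R}^d\to\mathbb{R}^m$ is $C^2$, that $\theta_*$ is an interior point of $\Theta$, and that, for $X\sim p(t,\cdot)$, the Jacobian $\nabla F(X)\in\mathbb{R}^{m\times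 d}$ and the vector $V(X):=\nabla F(X)\nabla F(X)^\top\theta_*+\Delta F(X)\in\mathbb{R}^m$ ($\Delta$ applied coordinatewise) have finite second moments. Then $\mathbb{E}[\nabla F(X)\nabla F(X)^\top]$ is invertible, and $$\Gamma_{\mathrm{SM}}:=\mathbb{E}[\nabla F(X)\nabla F(X)^\top]^{-1}\;\mathrm{Cov}\bigl(V(X)\bigr)\;\mathbb{E}[\nabla F(X)\nabla F(X)^\top]^{-1}$$ is positive semidefinite. Let $X_1,X_2,\dots$ be i.i.d. with density $p(t,\cdot)$, and for each $n$ let $\widehat\theta_n$ be a $\Theta$-valued random variable which is almost surely, whenever a minimizer exists, a minimizer over $\theta\in\Theta$ of $$\frac1n\sum_{i=1}^n\Bigl(|\nabla\log p_\theta(t,X_i)|^2+2\,\mathrm{tr}\bigl(\nabla^2\log p_\theta(t,X_i)\bigr)\Bigr).$$ Then, in distribution as $n\to\infty$, $$\sqrt n\,(\widehat\theta_n-\theta_*)\longrightarrow\mathcal{N}(0,\Gamma_{\mathrm{SM}}).$$ -/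

import Mathlib

open MeasureTheory ProbabilityTheory Filter
open scoped ENNReal RealInnerProductSpace Matrix

noncomputable section

/-- `ℝᵏ` with the Euclidean norm. -/
abbrev Vec (k : ℕ) : Type := EuclideanSpace ℝ (Fin k)

/-- A continuously differentiable, strictly positive probability density on `ℝᵈ`, so that its
score `∇ log f` is defined everywhere. -/
structure IsScoreDensity {d : ℕ} (f : Vec d → ℝ) : Prop where
  contDiff : ContDiff ℝ 1 f
  pos : ∀ x, 0 < f x
  integral_eq_one : ∫ x, f x = 1

/-- The measure on `ℝᵈ` with Lebesgue density `f`. -/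
def densityLaw {d : ℕ} (f : Vec d → ℝ) : Measure (Vec d) :=
  volume.withDensity fun x => ENNReal.ofReal (f x)

/-- The (Stein) score `∇ log f`. -/
def score {d : ℕ} (f : Vec d → ℝ) (x : Vec d) : Vec d :=
  gradient (fun y => Real.log (f y)) x

/-- The Hessian matrix of `g` at `x`. -/
def hessian {d : ℕ} (g : Vec d → ℝ) (x : Vec d) : Matrix (Fin d) (Fin d) ℝ :=
  Matrix.of fun i j =>
    iteratedFDeriv ℝ 2 g x ![EuclideanSpace.single i 1, EuclideanSpace.single j 1]

/-- The explicit score matching objective `𝔼_{X ∼ p} |s(X) - ∇ log p(X)|²`, with values in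
`[0, ∞]`. -/
def JESM {d : ℕ} (p : Vec d → ℝ) (s : Vec d → Vec d) : ℝ≥0∞ :=
  ∫⁻ x, ENNReal.ofReal (‖s x - score p x‖ ^ 2) ∂(densityLaw p)

/-- The empirical implicit score matching objective
`(1/n) ∑_{i < n} (|∇ log q(xᵢ)|² + 2 tr ∇² log q(xᵢ))` of a density `q` at the sample points
`x₀, …, xₙ₋₁`. -/
def empiricalISM {d : ℕ} (q : Vec d → ℝ) (n : ℕ) (x : ℕ → Vec d) : ℝ :=
  (1 / (n : ℝ)) * ∑ i ∈ Finset.range n,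
    (‖score q (x i)‖ ^ 2 + 2 * (hessian (fun y => Real.log (q y)) (x i)).trace)

/-- The Jacobian matrix `∇F(x)`: its `i`-th row is the gradient of the `i`-th coordinate of `F`. -/
def jacobian {d m : ℕ} (F : Vec d → Vec m) (x : Vec d) : Matrix (Fin m) (Fin d) ℝ :=
  Matrix.of fun i j => gradient (fun y => F y i) x j

/-- The coordinatewise Laplacian `ΔF(x)`. -/
def laplacianVec {d m : ℕ} (F : Vec d → Vec m) (x : Vec d) : Fin m → ℝ :=
  fun i => (hessian (fun y => F y i) x).trace

/-- The random vector `∇F(x) ∇F(x)ᵀ θ + ΔF(x)`. -/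
def smVector {d m : ℕ} (F : Vec d → Vec m) (θ : Vec m) (x : Vec d) : Fin m → ℝ :=
  (jacobian F x * (jacobian F x)ᵀ) *ᵥ (fun i => θ i) + laplacianVec F x

/-- The matrix `𝔼_{X ∼ μ} [∇F(X) ∇F(X)ᵀ]`. -/
def meanGram {d m : ℕ} (μ : Measure (Vec d)) (F : Vec d → Vec m) : Matrix (Fin m) (Fin m) ℝ :=
  Matrix.of fun i j => ∫ x, (jacobian F x * (jacobian F x)ᵀ) i j ∂μ

/-- The covariance matrix of the random vector `V(X)`, `X ∼ μ`. -/
def covMat {d m : ℕ} (μ : Measure (Vec d)) (V : Vec d → Fin m → ℝ) : Matrix (Fin m) (Fin m) ℝ :=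
  Matrix.of fun i j => covariance (fun x => V x i) (fun x => V x j) μ

/-- The sandwich covariance
`Γ = 𝔼[∇F ∇Fᵀ]⁻¹ · Cov(∇F ∇Fᵀ θ + ΔF) · 𝔼[∇F ∇Fᵀ]⁻¹`. -/
def gammaSM {d m : ℕ} (μ : Measure (Vec d)) (F : Vec d → Vec m) (θ : Vec m) :
    Matrix (Fin m) (Fin m) ℝ :=
  (meanGram μ F)⁻¹ * covMat μ (smVector F θ) * (meanGram μ F)⁻¹

end

/-! Part (1): if the objective vanishes, the two scores agree almost everywhere for `p`, hence
Lebesgue-a.e. because `p > 0`, hence everywhere by continuity. The log-densities then differ by a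
constant, normalization forces that constant to be zero, and identifiability gives `θ = θ*`
(`JESM_score_eq_zero_iff`).

Part (2): the log-density is affine in `θ`, so the empirical objective is the quadratic `θᵀAₙθ +
2θᵀbₙ`, with `Aₙ` the empirical Gram matrix and `bₙ` the average of `ΔF`. When `Aₙ` is invertible
and its stationary point lies in `Θ`, that point is the only minimizer, and `θ̂ₙ - θ* = -Aₙ⁻¹(Aₙθ* +
bₙ)` (`estimator_eq_of_minimizes`), where `Aₙθ* + bₙ` is the average of the `V(Xᵢ)`. Since `p V` is
the divergence of `p ∇F`, `V(X)` is centered (`integral_smVector_eq_zero`). The limit `G` of `Aₙ` is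
invertible: a null direction `v` would make `v · F` constant, so that moving `θ*` along `v` would
not change the density (`posDef_meanGram`). By the strong law and interiority of `θ*`, the formula
for `θ̂ₙ` almost surely holds for large `n`; the central limit theorem and Slutsky's lemma conclude.
-/

/-! ### Densities and scores -/

namespace IsScoreDensity

variable {d : ℕ} {f g : Vec d → ℝ}

lemma integrable (hf : IsScoreDensity f) : Integrable f := by
  by_contra h
  have := hf.integral_eq_one
  rw [integral_undef h] at this
  exact zero_ne_one this

lemma isProbabilityMeasure (hf : IsScoreDensity f) : IsProbabilityMeasure (densityLaw f) := by
  constructor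
  rw [densityLaw, withDensity_apply _ MeasurableSet.univ, Measure.restrict_univ,
    ← ofReal_integral_eq_lintegral_ofReal hf.integrable (ae_of_all _ fun x => (hf.pos x).le),
    hf.integral_eq_one, ENNReal.ofReal_one]

lemma volume_absolutelyContinuous (hf : IsScoreDensity f) : volume ≪ densityLaw f :=
  withDensity_absolutelyContinuous' hf.contDiff.continuous.measurable.ennreal_ofReal.aemeasurable
    (ae_of_all _ fun x => by simpa using hf.pos x)

/-- Positivity of `f` makes Lebesgue null sets out of null sets of its law, and continuous functions
that agree Lebesgue-a.e. agree everywhere. -/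
lemma eq_of_ae_eq (hf : IsScoreDensity f) {E : Type*} [TopologicalSpace E] [T2Space E]
    {u v : Vec d → E} (hu : Continuous u) (hv : Continuous v)
    (h : u =ᵐ[densityLaw f] v) : u = v :=
  (Continuous.ae_eq_iff_eq volume hu hv).1 (hf.volume_absolutelyContinuous.ae_eq h)

lemma integrable_densityLaw_iff (hf : IsScoreDensity f) {u : Vec d → ℝ} :
    Integrable u (densityLaw f) ↔ Integrable fun x => f x * u x := by
  rw [densityLaw, integrable_withDensity_iff_integrable_smul'
    hf.contDiff.continuous.measurable.ennreal_ofReal (ae_of_all _ fun x => ENNReal.ofReal_lt_top)]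
  simp_rw [ENNReal.toReal_ofReal (hf.pos _).le, smul_eq_mul]

lemma integral_densityLaw (hf : IsScoreDensity f) (u : Vec d → ℝ) :
    ∫ x, u x ∂densityLaw f = ∫ x, f x * u x := by
  rw [densityLaw, integral_withDensity_eq_integral_toReal_smul
    hf.contDiff.continuous.measurable.ennreal_ofReal (ae_of_all _ fun x => ENNReal.ofReal_lt_top)]
  simp_rw [ENNReal.toReal_ofReal (hf.pos _).le, smul_eq_mul]

lemma contDiff_log (hf : IsScoreDensity f) : ContDiff ℝ 1 fun x => Real.log (f x) :=
  hf.contDiff.log fun x => (hf.pos x).ne'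

lemma continuous_score (hf : IsScoreDensity f) : Continuous (score f) :=
  (InnerProductSpace.toDual ℝ (Vec d)).symm.continuous.comp
    (hf.contDiff_log.continuous_fderiv one_ne_zero)

/-- Integrating both sides forces `c = 1`. This serves both for equal scores and for null directions
of the exponential family. -/
lemma eq_of_eq_const_mul (hf : IsScoreDensity f) (hg : IsScoreDensity g) (c : ℝ)
    (h : ∀ x, f x = c * g x) : f = g := by
  have h1 := hf.integral_eq_one
  simp_rw [h, integral_const_mul, hg.integral_eq_one, mul_one] at h1
  ext x
  rw [h, h1, one_mul]

lemma eq_of_score_eq (hf : IsScoreDensity f) (hg : IsScoreDensity g)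
    (h : score f = score g) : f = g := by
  have hd : ∀ x, fderiv ℝ (fun y => Real.log (f y) - Real.log (g y)) x = 0 := by
    intro x
    rw [fderiv_fun_sub (hf.contDiff_log.differentiable one_ne_zero x)
      (hg.contDiff_log.differentiable one_ne_zero x), sub_eq_zero]
    exact (InnerProductSpace.toDual ℝ (Vec d)).symm.injective (congrFun h x)
  have hc := is_const_of_fderiv_eq_zero
    ((hf.contDiff_log.sub hg.contDiff_log).differentiable one_ne_zero) hd
  refine hf.eq_of_eq_const_mul hg (Real.exp (Real.log (f 0) - Real.log (g 0))) fun x => ?_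
  rw [← hc x 0, Real.exp_sub, Real.exp_log (hf.pos x), Real.exp_log (hg.pos x),
    div_mul_cancel₀ _ (hg.pos x).ne']

lemma JESM_score_eq_zero_iff (hf : IsScoreDensity f) (hg : IsScoreDensity g) :
    JESM f (score g) = 0 ↔ g = f := by
  refine ⟨fun h => hg.eq_of_score_eq hf ?_, fun h => by simp [JESM, h]⟩
  have hm : Measurable fun x => ENNReal.ofReal (‖score g x - score f x‖ ^ 2) :=
    (((hg.continuous_score.sub hf.continuous_score).norm.pow 2).measurable).ennreal_ofReal
  rw [JESM, lintegral_eq_zero_iff hm] at h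
  refine hf.eq_of_ae_eq hg.continuous_score hf.continuous_score ?_
  filter_upwards [h] with x hx
  have : ‖score g x - score f x‖ ^ 2 ≤ 0 := by simpa using hx
  have := pow_eq_zero_iff two_ne_zero |>.1 (this.antisymm (by positivity))
  exact sub_eq_zero.1 (norm_eq_zero.1 this)

end IsScoreDensity

/-! ### The integral of an integrable divergence -/

/-- The integral of the divergence of an integrable `C¹` vector field vanishes as soon as the
divergence is integrable. -/
lemma integral_sum_fderiv_eq_zero {E ι : Type*} [NormedAddCommGroup E] [InnerProductSpace ℝ E]
    [FiniteDimensional ℝ E] [MeasurableSpace E] [BorelSpace E] [Fintype ι] {μ : Measure E}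
    [μ.IsAddHaarMeasure] (e : ι → E) {W : ι → E → ℝ} (hW : ∀ j, ContDiff ℝ 1 (W j))
    (hint : ∀ j, Integrable (W j) μ)
    (hdiv : Integrable (fun x => ∑ j, fderiv ℝ (W j) x (e j)) μ) :
    ∫ x, ∑ j, fderiv ℝ (W j) x (e j) ∂μ = 0 := by
  -- Nothing is known about decay of `W` at infinity, so the integration by parts is done against
  -- the dilated cutoffs `χ(x / (n + 1))`.
  let χ : ContDiffBump (0 : E) := ⟨1, 2, one_pos, one_lt_two⟩
  have hχ : ContDiff ℝ 1 χ := χ.contDiff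
  have hχc : HasCompactSupport (fderiv ℝ χ) := χ.hasCompactSupport.fderiv ℝ
  obtain ⟨C, hC⟩ := hχc.exists_bound_of_continuous (hχ.continuous_fderiv one_ne_zero)
  let r : ℕ → ℝ := fun n => ((n : ℝ) + 1)⁻¹
  have hr : Tendsto r atTop (nhds 0) := by
    simpa [r, one_div] using tendsto_one_div_add_atTop_nhds_zero_nat (𝕜 := ℝ)
  have hr0 : ∀ n, 0 < r n := fun n => by positivity
  let φ : ℕ → E → ℝ := fun n x => χ (r n • x)
  have hφ : ∀ n, ContDiff ℝ 1 (φ n) := fun n => hχ.comp (contDiff_const_smul _)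
  have hφc : ∀ n, HasCompactSupport (φ n) := fun n =>
    χ.hasCompactSupport.comp_smul (hr0 n).ne'
  have hφ' : ∀ n x v, fderiv ℝ (φ n) x v = r n * fderiv ℝ χ (r n • x) v := by
    intro n x v
    have := ((hχ.differentiable one_ne_zero (r n • x)).hasFDerivAt).comp x
      ((hasFDerivAt_id x).const_smul (r n))
    have h2 : fderiv ℝ (φ n) x = _ := this.fderiv
    rw [h2]
    simp
  have hibp : ∀ n, ∫ x, φ n x * ∑ j, fderiv ℝ (W j) x (e j) ∂μ
      = - ∑ j, ∫ x, fderiv ℝ (φ n) x (e j) * W j x ∂μ := by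
    intro n
    have c1 : ∀ j, Continuous fun x => fderiv ℝ (W j) x (e j) := fun j =>
      ((hW j).continuous_fderiv one_ne_zero).clm_apply continuous_const
    have c2 : ∀ j, Continuous fun x => fderiv ℝ (φ n) x (e j) := fun j =>
      ((hφ n).continuous_fderiv one_ne_zero).clm_apply continuous_const
    have i1 : ∀ j, Integrable (fun x => φ n x * fderiv ℝ (W j) x (e j)) μ := fun j =>
      ((hφ n).continuous.mul (c1 j)).integrable_of_hasCompactSupport (hφc n).mul_right
    have i2 : ∀ j, Integrable (fun x => fderiv ℝ (φ n) x (e j) * W j x) μ := fun j =>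
      ((c2 j).mul (hW j).continuous).integrable_of_hasCompactSupport
        ((hφc n).fderiv_apply ℝ (e j)).mul_right
    have i3 : ∀ j, Integrable (fun x => φ n x * W j x) μ := fun j =>
      ((hφ n).continuous.mul (hW j).continuous).integrable_of_hasCompactSupport (hφc n).mul_right
    simp_rw [Finset.mul_sum]
    rw [integral_finsetSum _ fun j _ => i1 j, ← Finset.sum_neg_distrib]
    exact Finset.sum_congr rfl fun j _ => integral_mul_fderiv_eq_neg_fderiv_mul_of_integrable
      (i2 j) (i1 j) (i3 j) (fun x _ => (hφ n).differentiable one_ne_zero x)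
      (fun x _ => (hW j).differentiable one_ne_zero x)
  have hlim : Tendsto (fun n => ∫ x, φ n x * ∑ j, fderiv ℝ (W j) x (e j) ∂μ) atTop
      (nhds (∫ x, ∑ j, fderiv ℝ (W j) x (e j) ∂μ)) := by
    refine tendsto_integral_of_dominated_convergence
      (fun x => ‖∑ j, fderiv ℝ (W j) x (e j)‖)
      (fun n => (hφ n).continuous.aestronglyMeasurable.mul hdiv.aestronglyMeasurable) hdiv.norm
      (fun n => ae_of_all _ fun x => ?_) (ae_of_all _ fun x => ?_)
    · rw [norm_mul, Real.norm_of_nonneg χ.nonneg]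
      exact mul_le_of_le_one_left (norm_nonneg _) χ.le_one
    · have h1 : Tendsto (fun n => r n • x) atTop (nhds 0) := by
        simpa using hr.smul_const x
      have h2 := (χ.continuous.tendsto 0).comp h1
      have h3 : χ (0 : E) = 1 := χ.one_of_mem_closedBall (by simp [χ])
      rw [h3] at h2
      simpa using h2.mul_const (∑ j, fderiv ℝ (W j) x (e j))
  -- The gradient of the `n`-th cutoff is at most `C / (n + 1)`, so integrability of `W` alone kills
  -- the boundary term.
  have hlim0 : ∀ j, Tendsto (fun n => ∫ x, fderiv ℝ (φ n) x (e j) * W j x ∂μ) atTop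
      (nhds 0) := by
    intro j
    refine squeeze_zero_norm (a := fun n => r n * (C * ‖e j‖ * ∫ x, ‖W j x‖ ∂μ)) (fun n => ?_) ?_
    · rw [← integral_const_mul, ← integral_const_mul]
      refine norm_integral_le_of_norm_le (((hint j).norm.const_mul _).const_mul _)
        (ae_of_all _ fun x => ?_)
      rw [hφ', norm_mul, norm_mul, Real.norm_of_nonneg (hr0 n).le, mul_assoc]
      have := (fderiv ℝ χ (r n • x)).le_of_opNorm_le (hC (r n • x)) (e j)
      have h0 := (hr0 n).le
      gcongr
    · simpa using hr.mul_const _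
  refine tendsto_nhds_unique hlim ?_
  simp_rw [hibp]
  simpa using (tendsto_finsetSum Finset.univ fun j _ => hlim0 j).neg

/-! ### Gradients, Jacobians and Laplacians in coordinates -/

lemma gradient_apply {d : ℕ} (g : Vec d → ℝ) (x : Vec d) (j : Fin d) :
    gradient g x j = fderiv ℝ g x (EuclideanSpace.single j 1) := by
  rw [← toDual_gradient, InnerProductSpace.toDual_apply_apply, EuclideanSpace.inner_single_right]
  simp

lemma trace_hessian {d : ℕ} {g : Vec d → ℝ} (hg : ContDiff ℝ 2 g) (x : Vec d) :
    (hessian g x).trace = ∑ j, fderiv ℝ (fun y => fderiv ℝ g y (EuclideanSpace.single j 1)) x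
      (EuclideanSpace.single j 1) := by
  refine Finset.sum_congr rfl fun j _ => ?_
  have hd : DifferentiableAt ℝ (fderiv ℝ g) x :=
    (hg.fderiv_right (m := 1) (by norm_num)).differentiable one_ne_zero x
  rw [fderiv_clm_apply hd (differentiableAt_const _)]
  simp [hessian, iteratedFDeriv_two_apply]

section Coordinates

variable {d m : ℕ} {F : Vec d → Vec m}

lemma ContDiff.vec_apply {k : WithTop ℕ∞} (hF : ContDiff ℝ k F) (i : Fin m) :
    ContDiff ℝ k fun x => F x i :=
  (contDiff_piLp 2).1 hF i

lemma contDiff_jacobian (hF : ContDiff ℝ 2 F) (i : Fin m) (j : Fin d) :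
    ContDiff ℝ 1 fun x => jacobian F x i j := by
  simp only [jacobian, Matrix.of_apply, gradient_apply]
  exact ((hF.vec_apply i).fderiv_right (m := 1) (by norm_num)).clm_apply contDiff_const

lemma laplacianVec_eq (hF : ContDiff ℝ 2 F) (x : Vec d) (i : Fin m) :
    laplacianVec F x i = ∑ j, fderiv ℝ (fun y => jacobian F y i j) x
      (EuclideanSpace.single j 1) := by
  rw [laplacianVec, trace_hessian (hF.vec_apply i)]
  simp only [jacobian, Matrix.of_apply, gradient_apply]

lemma continuous_laplacianVec (hF : ContDiff ℝ 2 F) (i : Fin m) :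
    Continuous fun x => laplacianVec F x i := by
  simp_rw [laplacianVec_eq hF]
  exact continuous_finsetSum _ fun j _ =>
    ((contDiff_jacobian hF i j).continuous_fderiv one_ne_zero).clm_apply continuous_const

lemma continuous_gram (hF : ContDiff ℝ 2 F) (i i' : Fin m) :
    Continuous fun x => (jacobian F x * (jacobian F x)ᵀ) i i' := by
  simp_rw [Matrix.mul_apply, Matrix.transpose_apply]
  exact continuous_finsetSum _ fun j _ =>
    (contDiff_jacobian hF i j).continuous.mul (contDiff_jacobian hF i' j).continuous

lemma smVector_apply (θ : Vec m) (x : Vec d) (i : Fin m) :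
    smVector F θ x i
      = ∑ k, (jacobian F x * (jacobian F x)ᵀ) i k * θ k + laplacianVec F x i := rfl

lemma continuous_smVector (hF : ContDiff ℝ 2 F) (θ : Vec m) (i : Fin m) :
    Continuous fun x => smVector F θ x i := by
  simp_rw [smVector_apply]
  exact (continuous_finsetSum _ fun k _ => (continuous_gram hF i k).mul continuous_const).add
    (continuous_laplacianVec hF i)

lemma inner_vec_eq_sum (v w : Vec m) : ⟪v, w⟫ = ∑ i, v i * w i := by
  simp [PiLp.inner_apply, mul_comm]

lemma fderiv_inner_single (hF : ContDiff ℝ 2 F) (v : Vec m) (x : Vec d) (j : Fin d) :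
    fderiv ℝ (fun y => ⟪v, F y⟫) x (EuclideanSpace.single j 1) = ∑ i, v i * jacobian F x i j := by
  simp_rw [inner_vec_eq_sum]
  have hd : ∀ i, DifferentiableAt ℝ (fun y => F y i) x := fun i =>
    (hF.vec_apply i).differentiable two_ne_zero x
  rw [fderiv_fun_sum fun i _ => (hd i).const_mul (v i)]
  simp only [sum_apply, jacobian, Matrix.of_apply, gradient_apply]
  exact Finset.sum_congr rfl fun i _ => by
    rw [fderiv_const_mul (hd i)]
    rfl

lemma dotProduct_gram_mulVec (v : Fin m → ℝ) (x : Vec d) :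
    v ⬝ᵥ (jacobian F x * (jacobian F x)ᵀ) *ᵥ v = ∑ j, (∑ i, v i * jacobian F x i j) ^ 2 := by
  rw [← Matrix.mulVec_mulVec, Matrix.dotProduct_mulVec, Matrix.mulVec_transpose]
  simp [dotProduct, Matrix.vecMul, sq]

lemma dotProduct_gram_mulVec_nonneg (v : Fin m → ℝ) (x : Vec d) :
    0 ≤ v ⬝ᵥ (jacobian F x * (jacobian F x)ᵀ) *ᵥ v := by
  rw [dotProduct_gram_mulVec]
  positivity

end Coordinates

/-! ### Exponential families -/

section ExponentialFamily

variable {d m : ℕ} {F : Vec d → Vec m} {f : Vec d → ℝ} {θ : Vec m} {c : ℝ}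

lemma log_eq_of_exponential (hf : IsScoreDensity f)
    (hexp : ∀ x, f x = c * Real.exp ⟪θ, F x⟫) :
    (fun y => Real.log (f y)) = fun y => Real.log c + ⟪θ, F y⟫ := by
  have hc : c ≠ 0 := by
    rintro rfl
    simpa [hexp] using hf.pos 0
  ext y
  rw [hexp, Real.log_mul hc (Real.exp_pos _).ne', Real.log_exp]

lemma fderiv_log_of_exponential (hF : ContDiff ℝ 2 F) (hf : IsScoreDensity f)
    (hexp : ∀ x, f x = c * Real.exp ⟪θ, F x⟫) (x : Vec d) (j : Fin d) :
    fderiv ℝ (fun y => Real.log (f y)) x (EuclideanSpace.single j 1)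
      = ∑ i, θ i * jacobian F x i j := by
  rw [log_eq_of_exponential hf hexp, fderiv_const_add, fderiv_inner_single hF]

lemma norm_score_sq_of_exponential (hF : ContDiff ℝ 2 F) (hf : IsScoreDensity f)
    (hexp : ∀ x, f x = c * Real.exp ⟪θ, F x⟫) (x : Vec d) :
    ‖score f x‖ ^ 2 = θ.ofLp ⬝ᵥ (jacobian F x * (jacobian F x)ᵀ) *ᵥ θ.ofLp := by
  rw [EuclideanSpace.real_norm_sq_eq, dotProduct_gram_mulVec]
  simp_rw [score, gradient_apply, fderiv_log_of_exponential hF hf hexp]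

lemma trace_hessian_log_of_exponential (hF : ContDiff ℝ 2 F) (hf : IsScoreDensity f)
    (hexp : ∀ x, f x = c * Real.exp ⟪θ, F x⟫) (x : Vec d) :
    (hessian (fun y => Real.log (f y)) x).trace = θ.ofLp ⬝ᵥ laplacianVec F x := by
  have h2 : ContDiff ℝ 2 fun y => Real.log (f y) := by
    rw [log_eq_of_exponential hf hexp]
    exact contDiff_const.add (contDiff_const.inner ℝ hF)
  rw [trace_hessian h2]
  simp_rw [fderiv_log_of_exponential hF hf hexp, dotProduct, laplacianVec_eq hF, Finset.mul_sum]
  rw [Finset.sum_comm]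
  refine Finset.sum_congr rfl fun j _ => ?_
  have hd : ∀ i, DifferentiableAt ℝ (fun y => jacobian F y i j) x := fun i =>
    (contDiff_jacobian hF i j).differentiable one_ne_zero x
  rw [fderiv_fun_sum fun i _ => (hd i).const_mul (θ i), sum_apply]
  exact Finset.sum_congr rfl fun i _ => by
    rw [fderiv_const_mul (hd i)]
    rfl

/-- The score is `∇Fᵀθ` and the Laplacian of the log-density is `θ · ΔF`; the normalizing constant
disappears on differentiation, leaving an explicit quadratic in `θ`. -/
lemma empiricalISM_of_exponential (hF : ContDiff ℝ 2 F) (hf : IsScoreDensity f)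
    (hexp : ∀ x, f x = c * Real.exp ⟪θ, F x⟫) (n : ℕ) (x : ℕ → Vec d) :
    empiricalISM f n x
      = θ.ofLp ⬝ᵥ ((n : ℝ)⁻¹ • ∑ i ∈ Finset.range n, jacobian F (x i) * (jacobian F (x i))ᵀ)
          *ᵥ θ.ofLp
        + 2 * (θ.ofLp ⬝ᵥ ((n : ℝ)⁻¹ • ∑ i ∈ Finset.range n, laplacianVec F (x i))) := by
  simp_rw [empiricalISM, norm_score_sq_of_exponential hF hf hexp,
    trace_hessian_log_of_exponential hF hf hexp]
  rw [Matrix.smul_mulVec, Matrix.sum_mulVec, dotProduct_smul, dotProduct_smul, dotProduct_sum,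
    dotProduct_sum, Finset.sum_add_distrib, ← Finset.mul_sum, smul_eq_mul, smul_eq_mul]
  ring

variable (hF : ContDiff ℝ 2 F) (hf : IsScoreDensity f)
  (hgrad : ∀ i, MemLp (fun x => gradient (fun y => F y i) x) 2 (densityLaw f))

include hgrad in
lemma memLp_jacobian (i : Fin m) (j : Fin d) :
    MemLp (fun x => jacobian F x i j) 2 (densityLaw f) :=
  (EuclideanSpace.proj (𝕜 := ℝ) j).comp_memLp' (hgrad i)

include hgrad in
lemma integrable_gram (i i' : Fin m) :
    Integrable (fun x => (jacobian F x * (jacobian F x)ᵀ) i i') (densityLaw f) := by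
  simp_rw [Matrix.mul_apply, Matrix.transpose_apply]
  exact integrable_finsetSum _ fun j _ =>
    (memLp_jacobian hgrad i j).integrable_mul (memLp_jacobian hgrad i' j)

include hF hf hgrad in
/-- Stein's identity for the exponential family. -/
lemma integral_smVector_eq_zero (hexp : ∀ x, f x = c * Real.exp ⟪θ, F x⟫)
    (hV : ∀ i, MemLp (fun x => smVector F θ x i) 2 (densityLaw f)) (i : Fin m) :
    ∫ x, smVector F θ x i ∂densityLaw f = 0 := by
  have := hf.isProbabilityMeasure
  have hdf : ∀ x j, fderiv ℝ f x (EuclideanSpace.single j 1)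
      = f x * ∑ k, θ k * jacobian F x k j := by
    intro x j
    rw [← fderiv_log_of_exponential hF hf hexp,
      fderiv.log (hf.contDiff.differentiable one_ne_zero x) (hf.pos x).ne']
    simp [(hf.pos x).ne']
  -- Product rule: `∇f = f ∇Fᵀθ` yields the Gram term and differentiating `∇F` yields the Laplacian.
  have hdiv : ∀ x, ∑ j, fderiv ℝ (fun y => f y * jacobian F y i j) x (EuclideanSpace.single j 1)
      = f x * smVector F θ x i := by
    intro x
    rw [smVector_apply, laplacianVec_eq hF, mul_add]
    simp_rw [Matrix.mul_apply, Matrix.transpose_apply, Finset.sum_mul, Finset.mul_sum]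
    rw [Finset.sum_comm, ← Finset.sum_add_distrib]
    refine Finset.sum_congr rfl fun j _ => ?_
    rw [fderiv_fun_mul (hf.contDiff.differentiable one_ne_zero x)
      ((contDiff_jacobian hF i j).differentiable one_ne_zero x)]
    simp only [add_apply, smul_apply, smul_eq_mul, hdf,
      Finset.mul_sum]
    rw [add_comm]
    congr 1
    exact Finset.sum_congr rfl fun k _ => by ring
  rw [hf.integral_densityLaw]
  simp_rw [← hdiv]
  refine integral_sum_fderiv_eq_zero _ (fun j => hf.contDiff.mul (contDiff_jacobian hF i j))
    (fun j => ?_) ?_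
  · exact hf.integrable_densityLaw_iff.1 ((memLp_jacobian hgrad i j).integrable one_le_two)
  · simp_rw [hdiv]
    exact hf.integrable_densityLaw_iff.1 ((hV i).integrable one_le_two)

include hF hf hgrad in
-- The quadratic form at `v` is the mean of `|∇Fᵀv|²`. If it is zero, continuity gives `∇Fᵀv = 0`
-- everywhere, so `v · F` is constant and `hinj` applies.
lemma posDef_meanGram (hinj : ∀ v : Vec m, (∀ x y, ⟪v, F x⟫ = ⟪v, F y⟫) → v = 0) :
    (meanGram (densityLaw f) F).PosDef := by
  have hint := integrable_gram hgrad
  have hquad : ∀ v : Fin m → ℝ, v ⬝ᵥ meanGram (densityLaw f) F *ᵥ v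
      = ∫ x, v ⬝ᵥ (jacobian F x * (jacobian F x)ᵀ) *ᵥ v ∂densityLaw f := by
    intro v
    simp only [dotProduct, Matrix.mulVec, meanGram, Matrix.of_apply]
    rw [integral_finsetSum _ fun i _ =>
      (integrable_finsetSum _ fun k _ => (hint i k).mul_const (v k)).const_mul (v i)]
    refine Finset.sum_congr rfl fun i _ => ?_
    rw [integral_const_mul, integral_finsetSum _ fun k _ => (hint i k).mul_const (v k)]
    simp_rw [integral_mul_const]
  refine Matrix.PosDef.of_dotProduct_mulVec_pos ?_ fun {v} hv => ?_
  · ext i k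
    simp only [meanGram, Matrix.conjTranspose_apply, Matrix.of_apply, star_trivial,
      Matrix.mul_apply, Matrix.transpose_apply]
    simp_rw [mul_comm]
  · rw [star_trivial, hquad]
    refine lt_of_le_of_ne
      (integral_nonneg fun x => dotProduct_gram_mulVec_nonneg v x) fun h0 => hv ?_
    have hint' : Integrable (fun x => v ⬝ᵥ (jacobian F x * (jacobian F x)ᵀ) *ᵥ v)
        (densityLaw f) := by
      simp only [dotProduct, Matrix.mulVec]
      exact integrable_finsetSum _ fun i _ =>
        (integrable_finsetSum _ fun k _ => (hint i k).mul_const (v k)).const_mul (v i)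
    have hcont : Continuous fun x => v ⬝ᵥ (jacobian F x * (jacobian F x)ᵀ) *ᵥ v := by
      simp only [dotProduct, Matrix.mulVec]
      exact continuous_finsetSum _ fun i _ => continuous_const.mul
        (continuous_finsetSum _ fun k _ => (continuous_gram hF i k).mul continuous_const)
    have hae := (integral_eq_zero_iff_of_nonneg
      (fun x => dotProduct_gram_mulVec_nonneg v x) hint').1 h0.symm
    have hzero := hf.eq_of_ae_eq hcont continuous_zero hae
    have hz : ∀ x j, ∑ i, v i * jacobian F x i j = 0 := by
      intro x j
      have := congrFun hzero x
      simp only [dotProduct_gram_mulVec, Pi.zero_apply] at this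
      exact pow_eq_zero_iff two_ne_zero |>.1
        ((Finset.sum_eq_zero_iff_of_nonneg fun _ _ => sq_nonneg _).1 this j (Finset.mem_univ j))
    have hd : ∀ x, fderiv ℝ (fun y => ⟪WithLp.toLp 2 v, F y⟫) x = 0 := by
      intro x
      refine ContinuousLinearMap.coe_injective
        ((EuclideanSpace.basisFun (Fin d) ℝ).toBasis.ext fun j => ?_)
      simpa using (fderiv_inner_single hF (WithLp.toLp 2 v) x j).trans (hz x j)
    have := hinj (WithLp.toLp 2 v) (is_const_of_fderiv_eq_zero
      ((contDiff_const.inner ℝ hF).differentiable two_ne_zero) hd)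
    exact (WithLp.toLp_eq_zero 2).1 this

end ExponentialFamily

/-! ### Covariance matrices -/

lemma variance_sum_mul_eq_dotProduct_covMat {d m : ℕ} {μ : Measure (Vec d)}
    [IsProbabilityMeasure μ] {V : Vec d → Fin m → ℝ} (hV : ∀ i, MemLp (fun x => V x i) 2 μ)
    (u : Fin m → ℝ) :
    Var[fun x => ∑ i, u i * V x i; μ] = u ⬝ᵥ covMat μ V *ᵥ u := by
  have h : ∀ i, MemLp (fun x => u i * V x i) 2 μ := fun i => (hV i).const_mul (u i)
  rw [← covariance_self (memLp_finsetSum _ fun i _ => h i).aestronglyMeasurable.aemeasurable,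
    covariance_fun_sum_fun_sum (fun i => h i) (fun i => h i)]
  simp only [dotProduct, Matrix.mulVec, covMat, Matrix.of_apply, Finset.mul_sum,
    covariance_const_mul_left, covariance_const_mul_right]
  exact Finset.sum_congr rfl fun i _ => Finset.sum_congr rfl fun k _ => by ring

lemma posSemidef_covMat {d m : ℕ} {μ : Measure (Vec d)} [IsProbabilityMeasure μ]
    {V : Vec d → Fin m → ℝ} (hV : ∀ i, MemLp (fun x => V x i) 2 μ) :
    (covMat μ V).PosSemidef := by
  refine Matrix.PosSemidef.of_dotProduct_mulVec_nonneg ?_ fun u => ?_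
  · ext i k
    exact covariance_comm _ _
  · rw [star_trivial, ← variance_sum_mul_eq_dotProduct_covMat hV]
    exact variance_nonneg _ _

/-! ### Multivariate Gaussian limits -/

section Gaussian

variable {m : ℕ} {Ω : Type*} [MeasurableSpace Ω] {P : Measure Ω}

/-- The Cramér–Wold device: it reduces convergence of vectors to that of their scalar projections.
-/
lemma charFun_map_eq_charFun_map_inner {E : Type*} [NormedAddCommGroup E] [InnerProductSpace ℝ E]
    [MeasurableSpace E] [BorelSpace E] {Y : Ω → E} (hY : AEMeasurable Y P) (u : E) :
    charFun (P.map Y) u = charFun (P.map fun ω => ⟪u, Y ω⟫) 1 := by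
  have hc : Continuous fun y : E => ⟪u, y⟫ := continuous_const.inner continuous_id
  have hm : AEMeasurable (fun ω => ⟪u, Y ω⟫) P := hc.measurable.comp_aemeasurable hY
  rw [charFun_apply, charFun_apply, integral_map hY (by fun_prop), integral_map hm (by fun_prop)]
  simp [real_inner_comm]

variable [IsProbabilityMeasure P]

/-- The multivariate central limit theorem, for centered variables. -/
theorem tendstoInDistribution_multivariateGaussian {C : Matrix (Fin m) (Fin m) ℝ}
    (hC : C.PosSemidef) {Y : ℕ → Ω → Vec m} (hindep : iIndepFun Y P)
    (hident : ∀ i, IdentDistrib (Y i) (Y 0) P P) (hL2 : MemLp (Y 0) 2 P)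
    (hmean : ∀ u : Vec m, ∫ ω, ⟪u, Y 0 ω⟫ ∂P = 0)
    (hvar : ∀ u : Vec m, Var[fun ω => ⟪u, Y 0 ω⟫; P] = u.ofLp ⬝ᵥ C *ᵥ u.ofLp) :
    TendstoInDistribution (fun (n : ℕ) ω => (√n)⁻¹ • ∑ k ∈ Finset.range n, Y k ω) atTop
      (id : Vec m → Vec m) (fun _ => P) (multivariateGaussian 0 C) where
  forall_aemeasurable n :=
    (measurable_const_smul (√n : ℝ)⁻¹).comp_aemeasurable
      (Finset.aemeasurable_fun_sum _ fun k _ => (hident k).aemeasurable_fst)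
  tendsto := by
    refine ProbabilityMeasure.tendsto_iff_tendsto_charFun.2 fun u => ?_
    have hc : Continuous fun y : Vec m => ⟪u, y⟫ := continuous_const.inner continuous_id
    have h1 := tendstoInDistribution_inv_sqrt_mul_sum_sub (P := P) (X := fun k ω => ⟪u, Y k ω⟫)
      (Y := id) (P' := gaussianReal 0 Var[fun ω => ⟪u, Y 0 ω⟫; P].toNNReal) HasLaw.id
      (hL2.const_inner u) (hindep.comp (fun _ y => ⟪u, y⟫) fun _ => hc.measurable)
      (fun i => (hident i).comp hc.measurable)
    -- The direction `u` is already inside the projection, so the scalar characteristic function is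
    -- needed only at `1`.
    have h2 := ProbabilityMeasure.tendsto_iff_tendsto_charFun.1 h1.tendsto 1
    simp only [ProbabilityMeasure.coe_mk, Measure.map_id, charFun_gaussianReal, hmean, mul_zero,
      sub_zero] at h2
    simp only [ProbabilityMeasure.coe_mk, Measure.map_id, charFun_multivariateGaussian hC]
    convert! h2 using 2 with n
    · rw [charFun_map_eq_charFun_map_inner]
      · simp_rw [inner_smul_right, inner_sum]
      · exact (measurable_const_smul (√n : ℝ)⁻¹).comp_aemeasurable
          (Finset.aemeasurable_fun_sum _ fun k _ => (hident k).aemeasurable_fst)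
    · have h0 : (0 : ℝ) ≤ u.ofLp ⬝ᵥ C *ᵥ u.ofLp := by simpa using hC.dotProduct_mulVec_nonneg u.ofLp
      rw [hvar, Real.coe_toNNReal _ h0]
      simp

/-- A linear image of a centered Gaussian vector is a Gaussian vector. -/
lemma map_toEuclideanCLM_multivariateGaussian {C : Matrix (Fin m) (Fin m) ℝ} (hC : C.PosSemidef)
    (B : Matrix (Fin m) (Fin m) ℝ) :
    (multivariateGaussian 0 C).map (Matrix.toEuclideanCLM (𝕜 := ℝ) B)
      = multivariateGaussian 0 (B * C * Bᵀ) := by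
  have hBC : (B * C * Bᵀ).PosSemidef := by simpa using hC.mul_mul_conjTranspose_same B
  refine Measure.ext_of_charFun ?_
  ext u
  have : charFun ((multivariateGaussian 0 C).map (Matrix.toEuclideanCLM (𝕜 := ℝ) B)) u
      = charFun (multivariateGaussian 0 C) (Matrix.toEuclideanCLM (𝕜 := ℝ) Bᵀ u) := by
    rw [charFun_apply, charFun_apply, integral_map (by fun_prop) (by fun_prop)]
    congr with z
    rw [EuclideanSpace.inner_eq_star_dotProduct, EuclideanSpace.inner_eq_star_dotProduct,
      Matrix.ofLp_toEuclideanCLM, Matrix.ofLp_toEuclideanCLM, star_trivial, star_trivial,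
      Matrix.dotProduct_mulVec, Matrix.mulVec_transpose]
  rw [this, charFun_multivariateGaussian hC, charFun_multivariateGaussian hBC,
    Matrix.ofLp_toEuclideanCLM]
  congr 3
  · simp
  · rw [← Matrix.mulVec_mulVec, ← Matrix.mulVec_mulVec, Matrix.dotProduct_mulVec _ B,
      ← Matrix.mulVec_transpose]

end Gaussian

/-! ### Quadratic objectives -/

/-- Completing the square around the stationary point `v`. -/
lemma quadratic_sub_eq {m : ℕ} {A : Matrix (Fin m) (Fin m) ℝ} (hA : Aᵀ = A)
    {b u v : Fin m → ℝ} (hv : A *ᵥ v = -b) :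
    (u ⬝ᵥ A *ᵥ u + 2 * (u ⬝ᵥ b)) - (v ⬝ᵥ A *ᵥ v + 2 * (v ⬝ᵥ b)) = (u - v) ⬝ᵥ A *ᵥ (u - v) := by
  have h1 : v ⬝ᵥ A *ᵥ u = - (u ⬝ᵥ b) := by
    rw [Matrix.dotProduct_mulVec, ← Matrix.mulVec_transpose, hA, hv, neg_dotProduct,
      dotProduct_comm]
  rw [Matrix.mulVec_sub, sub_dotProduct, dotProduct_sub, dotProduct_sub, h1, hv]
  simp only [dotProduct_neg]
  ring

lemma posDef_of_posSemidef_of_isUnit_det {m : ℕ} {A : Matrix (Fin m) (Fin m) ℝ}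
    (hA : A.PosSemidef) (hdet : IsUnit A.det) : A.PosDef :=
  hA.posDef_iff_isUnit.2 ((Matrix.isUnit_iff_isUnit_det A).2 hdet)

/-! ### Estimators which solve a random linear equation -/

section Slutsky

variable {m : ℕ} {Ω : Type*} [MeasurableSpace Ω] {P : Measure Ω}

lemma Matrix.tendsto_inv {ι α : Type*} [Fintype ι] [DecidableEq ι] {l : Filter α}
    {A : α → Matrix ι ι ℝ} {G : Matrix ι ι ℝ} (hG : IsUnit G.det) (h : Tendsto A l (nhds G)) :
    Tendsto (fun n => (A n)⁻¹) l (nhds G⁻¹) := by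
  simp only [Matrix.inv_def, Ring.inverse_eq_inv']
  exact ((((continuous_id.matrix_det).tendsto G).comp h).inv₀ hG.ne_zero).smul
    (((continuous_id.matrix_adjugate).tendsto G).comp h)

/-- Adjugate over determinant is measurable on all matrices, singular ones included, since `0⁻¹ =
0`. -/
lemma aemeasurable_matrix_inv_apply {A : Ω → Matrix (Fin m) (Fin m) ℝ}
    (hA : ∀ i j, AEMeasurable (fun ω => A ω i j) P) (i j : Fin m) :
    AEMeasurable (fun ω => (A ω)⁻¹ i j) P := by
  have hdet : Continuous fun a : Fin m → Fin m → ℝ => (Matrix.of a).det :=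
    continuous_id.matrix_det
  have hadj : Continuous fun a : Fin m → Fin m → ℝ => (Matrix.of a).adjugate i j :=
    continuous_id.matrix_adjugate.matrix_elem i j
  have hinv : Measurable fun a : Fin m → Fin m → ℝ => (Matrix.of a)⁻¹ i j := by
    simp only [Matrix.inv_def, Ring.inverse_eq_inv', Matrix.smul_apply, smul_eq_mul]
    exact hdet.measurable.inv.mul hadj.measurable
  have hA' : AEMeasurable (fun ω i j => A ω i j) P :=
    aemeasurable_pi_lambda _ fun i => aemeasurable_pi_lambda _ fun j => hA i j
  exact hinv.comp_aemeasurable hA'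

variable [IsProbabilityMeasure P]

/-- If `Sₙ` converges in distribution to `N(0, C)`, `Aₙ → G` almost surely with `G` invertible, and
almost surely `Tₙ = -Aₙ⁻¹ Sₙ` for large `n`, then `Tₙ` converges in distribution to
`N(0, G⁻¹ C G⁻ᵀ)`. -/
theorem tendstoInDistribution_of_eventually_eq_neg_inv {G C : Matrix (Fin m) (Fin m) ℝ}
    (hG : IsUnit G.det) (hC : C.PosSemidef) {A : ℕ → Ω → Matrix (Fin m) (Fin m) ℝ}
    {S T : ℕ → Ω → Vec m} (hA : ∀ n i j, AEMeasurable (fun ω => A n ω i j) P)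
    (hAG : ∀ᵐ ω ∂P, Tendsto (fun n => A n ω) atTop (nhds G))
    (hS : TendstoInDistribution S atTop (id : Vec m → Vec m) (fun _ => P)
      (multivariateGaussian 0 C))
    (hT : ∀ n, AEMeasurable (T n) P)
    (hST : ∀ᵐ ω ∂P, ∀ᶠ n in atTop,
      T n ω = -Matrix.toEuclideanCLM (𝕜 := ℝ) (A n ω)⁻¹ (S n ω)) :
    TendstoInDistribution T atTop (id : Vec m → Vec m) (fun _ => P)
      (multivariateGaussian 0 (G⁻¹ * C * G⁻¹ᵀ)) := by
  let B : ℕ → Ω → Fin m → Fin m → ℝ := fun n ω i j => (A n ω)⁻¹ i j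
  have hB : ∀ n, AEMeasurable (B n) P := fun n =>
    aemeasurable_pi_lambda _ fun i => aemeasurable_pi_lambda _ fun j =>
      aemeasurable_matrix_inv_apply (hA n) i j
  have hBG : TendstoInMeasure P B atTop fun _ i j => G⁻¹ i j := by
    refine tendstoInMeasure_of_tendsto_ae (fun n => (hB n).aestronglyMeasurable) ?_
    filter_upwards [hAG] with ω hω
    have h := Matrix.tendsto_inv hG hω
    exact tendsto_pi_nhds.2 fun i => tendsto_pi_nhds.2 fun j =>
      ((continuous_id.matrix_elem i j).tendsto _).comp h
  let g : Vec m × (Fin m → Fin m → ℝ) → Vec m := fun p =>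
    -Matrix.toEuclideanCLM (𝕜 := ℝ) (Matrix.of p.2) p.1
  have hg : Continuous g := by
    have : Continuous fun p : Vec m × (Fin m → Fin m → ℝ) =>
        WithLp.toLp 2 (Matrix.of p.2 *ᵥ p.1.ofLp) :=
      (PiLp.continuous_toLp 2 _).comp (Continuous.matrix_mulVec continuous_snd
        ((PiLp.continuous_ofLp 2 _).comp continuous_fst))
    exact this.neg
  -- Slutsky's lemma: the pair `(Sₙ, Aₙ⁻¹)` has a limit in law because its second component has a
  -- constant limit.
  have hlim := hS.continuous_comp_prodMk_of_tendstoInMeasure_const hg hBG hB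
  have hlim' : TendstoInDistribution (fun n ω => g (S n ω, B n ω)) atTop (id : Vec m → Vec m)
      (fun _ => P) (multivariateGaussian 0 (G⁻¹ * C * G⁻¹ᵀ)) := by
    refine ⟨hlim.forall_aemeasurable, aemeasurable_id, ?_⟩
    -- The limit is the image of `N(0, C)` under `-G⁻¹`; the sign cancels in the covariance.
    have hmap : (multivariateGaussian 0 (G⁻¹ * C * G⁻¹ᵀ)).map (id : Vec m → Vec m)
        = (multivariateGaussian 0 C).map fun z : Vec m => g (id z, fun i j => G⁻¹ i j) := by
      have h1 : (fun z : Vec m => g (id z, fun i j => G⁻¹ i j))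
          = Matrix.toEuclideanCLM (𝕜 := ℝ) (-G⁻¹) := by
        ext z : 1
        rw [map_neg]
        rfl
      rw [h1, map_toEuclideanCLM_multivariateGaussian hC, Measure.map_id]
      simp
    have hpm : (⟨_, Measure.isProbabilityMeasure_map aemeasurable_id⟩ : ProbabilityMeasure (Vec m))
        = ⟨_, Measure.isProbabilityMeasure_map hlim.aemeasurable_limit⟩ := Subtype.ext hmap
    rw [hpm]
    exact hlim.tendsto
  refine tendstoInDistribution_of_tendstoInMeasure_sub T id hlim' ?_ hT
  refine tendstoInMeasure_of_tendsto_ae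
    (fun n => ((hT n).sub (hlim'.forall_aemeasurable n)).aestronglyMeasurable) ?_
  filter_upwards [hST] with ω hω
  -- The difference of the two sequences is almost surely zero from some `n` on.
  refine tendsto_const_nhds.congr' ?_
  filter_upwards [hω] with n hn
  simp only [Pi.sub_apply, Pi.zero_apply]
  exact (sub_eq_zero.2 hn).symm

end Slutsky

/-! ### Strong law for the score matching statistics -/

lemma ae_tendsto_average_of_hasLaw {Ω 𝓧 : Type*} [MeasurableSpace Ω] [MeasurableSpace 𝓧]
    {P : Measure Ω} {μ : Measure 𝓧} {X : ℕ → Ω → 𝓧} (hindep : iIndepFun X P)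
    (hlaw : ∀ i, HasLaw (X i) μ P) {φ : 𝓧 → ℝ} (hφ : Measurable φ) (hint : Integrable φ μ) :
    ∀ᵐ ω ∂P, Tendsto (fun n : ℕ => (n : ℝ)⁻¹ * ∑ i ∈ Finset.range n, φ (X i ω)) atTop
      (nhds (∫ x, φ x ∂μ)) := by
  have hid : ∀ i, IdentDistrib (fun ω => φ (X i ω)) (fun ω => φ (X 0 ω)) P P := fun i =>
    ((hlaw i).identDistrib (hlaw 0)).comp hφ
  have h0 : Integrable (fun ω => φ (X 0 ω)) P := by
    have := hint
    rw [← (hlaw 0).map_eq] at this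
    exact this.comp_aemeasurable (hlaw 0).aemeasurable
  have h := strong_law_ae (μ := P) (fun i ω => φ (X i ω)) h0
    (fun i j hij => (hindep.comp (fun _ => φ) fun _ => hφ).indepFun hij) hid
  have h1 : ∫ ω, φ (X 0 ω) ∂P = ∫ x, φ x ∂μ := (hlaw 0).integral_comp hint.aestronglyMeasurable
  rw [h1] at h
  exact h

/-! ### The score matching estimator -/

section Estimator

variable {d m : ℕ}

/-- The empirical Gram matrix `(1/n) ∑_{i < n} ∇F(xᵢ) ∇F(xᵢ)ᵀ`. -/
noncomputable def empiricalGram (F : Vec d → Vec m) (n : ℕ) (x : ℕ → Vec d) :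
    Matrix (Fin m) (Fin m) ℝ :=
  (n : ℝ)⁻¹ • ∑ i ∈ Finset.range n, jacobian F (x i) * (jacobian F (x i))ᵀ

lemma empiricalGram_apply (F : Vec d → Vec m) (n : ℕ) (x : ℕ → Vec d) (i j : Fin m) :
    empiricalGram F n x i j = (n : ℝ)⁻¹ * ∑ k ∈ Finset.range n,
      (jacobian F (x k) * (jacobian F (x k))ᵀ) i j := by
  simp [empiricalGram, Matrix.sum_apply]

lemma posSemidef_empiricalGram (F : Vec d → Vec m) (n : ℕ) (x : ℕ → Vec d) :
    (empiricalGram F n x).PosSemidef := by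
  refine Matrix.PosSemidef.smul (Matrix.posSemidef_sum _ fun i _ => ?_) (by positivity)
  simpa using Matrix.posSemidef_self_mul_conjTranspose (jacobian F (x i))

/-- Half the gradient of the empirical objective at `θ` is a sample average of `smVector`, to which
the limit theorems apply. -/
lemma empiricalGram_mulVec_add (F : Vec d → Vec m) (θ : Vec m) (n : ℕ) (x : ℕ → Vec d) :
    empiricalGram F n x *ᵥ θ.ofLp + (n : ℝ)⁻¹ • ∑ i ∈ Finset.range n, laplacianVec F (x i)
      = (n : ℝ)⁻¹ • ∑ i ∈ Finset.range n, smVector F θ (x i) := by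
  rw [empiricalGram, Matrix.smul_mulVec, Matrix.sum_mulVec, ← smul_add,
    ← Finset.sum_add_distrib]
  rfl

/-- If the empirical Gram matrix is invertible and the stationary point of the empirical objective
belongs to the parameter set, it is the estimator. -/
lemma estimator_eq_of_minimizes {F : Vec d → Vec m} (hF : ContDiff ℝ 2 F) {Θ : Set (Vec m)}
    {f : Θ → Vec d → ℝ} (hf : ∀ θ, IsScoreDensity (f θ))
    (hexp : ∀ θ : Θ, ∃ c : ℝ, ∀ x, f θ x = c * Real.exp ⟪(θ : Vec m), F x⟫)
    (θs : Vec m) {n : ℕ} {x : ℕ → Vec d} (hdet : IsUnit (empiricalGram F n x).det)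
    (hmem : θs - Matrix.toEuclideanCLM (𝕜 := ℝ) (empiricalGram F n x)⁻¹
      ((n : ℝ)⁻¹ • ∑ i ∈ Finset.range n, WithLp.toLp 2 (smVector F θs (x i))) ∈ Θ)
    {θ' : Θ} (hmin : (∃ θ₀ : Θ, ∀ θ : Θ, empiricalISM (f θ₀) n x ≤ empiricalISM (f θ) n x) →
      ∀ θ : Θ, empiricalISM (f θ') n x ≤ empiricalISM (f θ) n x) :
    (θ' : Vec m) - θs = -Matrix.toEuclideanCLM (𝕜 := ℝ) (empiricalGram F n x)⁻¹
      ((n : ℝ)⁻¹ • ∑ i ∈ Finset.range n, WithLp.toLp 2 (smVector F θs (x i))) := by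
  set A := empiricalGram F n x with hA
  set w := (n : ℝ)⁻¹ • ∑ i ∈ Finset.range n, WithLp.toLp 2 (smVector F θs (x i)) with hw
  set b := (n : ℝ)⁻¹ • ∑ i ∈ Finset.range n, laplacianVec F (x i) with hb
  have hpos : A.PosDef :=
    posDef_of_posSemidef_of_isUnit_det (posSemidef_empiricalGram F n x) hdet
  have hsymm : Aᵀ = A := by simpa using hpos.isHermitian.eq
  let θ₀ : Θ := ⟨_, hmem⟩
  have hstat : A *ᵥ (θ₀ : Vec m).ofLp = -b := by
    have h1 : (θ₀ : Vec m).ofLp = θs.ofLp - A⁻¹ *ᵥ w.ofLp := by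
      simp [θ₀, Matrix.ofLp_toEuclideanCLM]
    have h2 : A *ᵥ θs.ofLp + b = w.ofLp := by
      rw [hA, hb, empiricalGram_mulVec_add]
      simp [hw, WithLp.ofLp_sum]
    rw [h1, Matrix.mulVec_sub, Matrix.mulVec_mulVec, Matrix.mul_nonsing_inv _ hdet,
      Matrix.one_mulVec, ← h2]
    abel
  have hobj : ∀ θ : Θ, empiricalISM (f θ) n x - empiricalISM (f θ₀) n x
      = ((θ : Vec m).ofLp - (θ₀ : Vec m).ofLp) ⬝ᵥ A *ᵥ
        ((θ : Vec m).ofLp - (θ₀ : Vec m).ofLp) := by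
    intro θ
    obtain ⟨c, hc⟩ := hexp θ
    obtain ⟨c₀, hc₀⟩ := hexp θ₀
    rw [empiricalISM_of_exponential hF (hf θ) hc, empiricalISM_of_exponential hF (hf θ₀) hc₀,
      ← quadratic_sub_eq hsymm hstat]
    rfl
  have hθ₀ : ∀ θ : Θ, empiricalISM (f θ₀) n x ≤ empiricalISM (f θ) n x := by
    intro θ
    rw [← sub_nonneg, hobj]
    simpa using hpos.posSemidef.dotProduct_mulVec_nonneg
      ((θ : Vec m).ofLp - (θ₀ : Vec m).ofLp)
  -- The estimator is constrained only when a minimizer exists; `θ₀` is one, and strict convexity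
  -- then makes it the only one.
  have hle := hmin ⟨θ₀, hθ₀⟩ θ₀
  have heq : (θ' : Vec m).ofLp - (θ₀ : Vec m).ofLp = 0 := by
    by_contra hne
    have := hpos.dotProduct_mulVec_pos hne
    rw [star_trivial, ← hobj] at this
    linarith
  have : (θ' : Vec m) = θ₀ := WithLp.ofLp_injective 2 (sub_eq_zero.1 heq)
  rw [this]
  simp [θ₀]

end Estimator

/-- Asymptotic normality of the score matching estimator in an exponential family. -/
theorem tendstoInDistribution_scoreMatching {d m : ℕ} {F : Vec d → Vec m} (hF : ContDiff ℝ 2 F)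
    {Θ : Set (Vec m)} {f : Θ → Vec d → ℝ} (hf : ∀ θ, IsScoreDensity (f θ))
    (hexp : ∀ θ : Θ, ∃ c : ℝ, ∀ x, f θ x = c * Real.exp ⟪(θ : Vec m), F x⟫)
    (θs : Θ) (hint : (θs : Vec m) ∈ interior Θ)
    (hgrad : ∀ i, MemLp (fun x => gradient (fun y => F y i) x) 2 (densityLaw (f θs)))
    (hV : ∀ i, MemLp (fun x => smVector F θs x i) 2 (densityLaw (f θs)))
    (hG : (meanGram (densityLaw (f θs)) F).PosDef)
    {Ω : Type*} [MeasurableSpace Ω] (P : Measure Ω) [IsProbabilityMeasure P]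
    (X : ℕ → Ω → Vec d) (hindep : iIndepFun X P)
    (hlaw : ∀ i, HasLaw (X i) (densityLaw (f θs)) P)
    (θhat : ℕ → Ω → Θ) (hmeas : ∀ n, AEMeasurable (θhat n) P)
    (hmin : ∀ n, ∀ᵐ ω ∂P,
      (∃ θ₀ : Θ, ∀ θ : Θ, empiricalISM (f θ₀) n (fun i => X i ω) ≤
        empiricalISM (f θ) n (fun i => X i ω)) →
      ∀ θ : Θ, empiricalISM (f (θhat n ω)) n (fun i => X i ω) ≤
        empiricalISM (f θ) n (fun i => X i ω)) :
    TendstoInDistribution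
      (fun (n : ℕ) ω => Real.sqrt n • ((θhat n ω : Vec m) - (θs : Vec m))) atTop
      (id : Vec m → Vec m) (fun _ => P)
      (multivariateGaussian 0 (gammaSM (densityLaw (f θs)) F θs)) := by
  set μ := densityLaw (f θs) with hμ
  have : IsProbabilityMeasure μ := (hf θs).isProbabilityMeasure
  obtain ⟨c, hc⟩ := hexp θs
  have hmean : ∀ i, ∫ x, smVector F θs x i ∂μ = 0 := integral_smVector_eq_zero hF (hf θs) hgrad hc hV
  have hdet : IsUnit (meanGram μ F).det := (Matrix.isUnit_iff_isUnit_det _).1 hG.isUnit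
  have hsymm : ((meanGram μ F)⁻¹)ᵀ = (meanGram μ F)⁻¹ := by simpa using hG.inv.isHermitian.eq
  have hVc : Continuous fun x => WithLp.toLp 2 (smVector F θs x) :=
    (PiLp.continuous_toLp 2 _).comp (continuous_pi fun i => continuous_smVector hF θs i)
  have hid : ∀ i, IdentDistrib (fun ω => WithLp.toLp 2 (smVector F θs (X i ω)))
      (fun ω => WithLp.toLp 2 (smVector F θs (X 0 ω))) P P := fun i =>
    ((hlaw i).identDistrib (hlaw 0)).comp hVc.measurable
  have hVL2 : MemLp (fun x => WithLp.toLp 2 (smVector F θs x)) 2 μ :=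
    MemLp.of_eval_piLp hV
  have hinner : ∀ (u : Vec m) x, ⟪u, WithLp.toLp 2 (smVector F θs x)⟫
      = ∑ i, u i * smVector F θs x i := fun u x => inner_vec_eq_sum _ _
  have hsumc : ∀ u : Vec m, Continuous fun x => ∑ i, u i * smVector F θs x i := fun u =>
    continuous_finsetSum _ fun i _ => continuous_const.mul (continuous_smVector hF θs i)
  have hclt := tendstoInDistribution_multivariateGaussian (P := P) (posSemidef_covMat hV)
    (Y := fun i ω => WithLp.toLp 2 (smVector F θs (X i ω)))
    (hindep.comp (fun _ x => WithLp.toLp 2 (smVector F θs x)) fun _ => hVc.measurable) hid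
    (by
      have h := hVL2
      rw [← (hlaw 0).map_eq] at h
      exact h.comp_of_map (hlaw 0).aemeasurable)
    (fun u => by
      simp_rw [hinner]
      refine ((hlaw 0).integral_comp (hsumc u).aestronglyMeasurable).trans ?_
      rw [integral_finsetSum _ fun i _ => ((hV i).integrable one_le_two).const_mul (u i)]
      simp_rw [integral_const_mul, hmean, mul_zero, Finset.sum_const_zero])
    (fun u => by
      simp_rw [hinner]
      rw [← variance_sum_mul_eq_dotProduct_covMat hV, ← (hlaw 0).map_eq,
        variance_map (hsumc u).aemeasurable (hlaw 0).aemeasurable]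
      rfl)
  have hgramlim : ∀ᵐ ω ∂P, Tendsto (fun n => empiricalGram F n fun i => X i ω) atTop
      (nhds (meanGram μ F)) := by
    have h : ∀ᵐ ω ∂P, ∀ i j, Tendsto (fun n => empiricalGram F n (fun i => X i ω) i j) atTop
        (nhds (meanGram μ F i j)) := by
      refine ae_all_iff.2 fun i => ae_all_iff.2 fun j => ?_
      simp_rw [empiricalGram_apply]
      exact ae_tendsto_average_of_hasLaw hindep hlaw (continuous_gram hF i j).measurable
        (integrable_gram hgrad i j)
    filter_upwards [h] with ω hω
    exact tendsto_pi_nhds.2 fun i => tendsto_pi_nhds.2 fun j => hω i j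
  have hVlim : ∀ᵐ ω ∂P, Tendsto (fun n : ℕ => (n : ℝ)⁻¹ • ∑ i ∈ Finset.range n,
      WithLp.toLp 2 (smVector F θs (X i ω))) atTop (nhds 0) := by
    have h : ∀ᵐ ω ∂P, ∀ i, Tendsto (fun n : ℕ => (n : ℝ)⁻¹ * ∑ k ∈ Finset.range n,
        smVector F θs (X k ω) i) atTop (nhds 0) := by
      refine ae_all_iff.2 fun i => ?_
      rw [← hmean i]
      exact ae_tendsto_average_of_hasLaw hindep hlaw (continuous_smVector hF θs i).measurable
        ((hV i).integrable one_le_two)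
    filter_upwards [h] with ω hω
    have h2 := ((PiLp.continuous_toLp 2 fun _ : Fin m => ℝ).tendsto 0).comp
      (tendsto_pi_nhds.2 hω : Tendsto (fun (n : ℕ) i => (n : ℝ)⁻¹ * ∑ k ∈ Finset.range n,
        smVector F θs (X k ω) i) atTop (nhds 0))
    rw [WithLp.toLp_zero] at h2
    refine h2.congr fun n => ?_
    ext i
    simp [WithLp.ofLp_sum]
  have hgram : gammaSM μ F θs
      = (meanGram μ F)⁻¹ * covMat μ (smVector F θs) * ((meanGram μ F)⁻¹)ᵀ := by
    rw [hsymm, gammaSM]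
  rw [hgram]
  refine tendstoInDistribution_of_eventually_eq_neg_inv hdet (posSemidef_covMat hV)
    (A := fun n ω => empiricalGram F n fun i => X i ω) ?_ hgramlim hclt (fun n => ?_) ?_
  · intro n i j
    simp_rw [empiricalGram_apply]
    exact (Finset.aemeasurable_fun_sum _ fun k _ =>
      (continuous_gram hF i j).measurable.comp_aemeasurable (hlaw k).aemeasurable).const_mul _
  · exact (measurable_const_smul (√n : ℝ)).comp_aemeasurable
      ((measurable_subtype_coe.comp_aemeasurable (hmeas n)).sub_const _)
  -- The exceptional null set in `hmin` depends on `n`; countably many of them are discarded at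
  -- once.
  · filter_upwards [hgramlim, hVlim, ae_all_iff.2 hmin] with ω hGω hVω hmω
    have hunit : ∀ᶠ n in atTop, IsUnit (empiricalGram F n fun i => X i ω).det := by
      filter_upwards [(((continuous_id.matrix_det).tendsto (meanGram μ F)).comp hGω).eventually_ne
        hdet.ne_zero] with n hn
      exact isUnit_iff_ne_zero.2 hn
    -- The stationary points converge to `θ*`, so they eventually enter `Θ`, a neighborhood of `θ*`.
    have hstat : Tendsto (fun n : ℕ => (θs : Vec m) -
        Matrix.toEuclideanCLM (𝕜 := ℝ) (empiricalGram F n fun i => X i ω)⁻¹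
          ((n : ℝ)⁻¹ • ∑ i ∈ Finset.range n, WithLp.toLp 2 (smVector F θs (X i ω)))) atTop
        (nhds θs) := by
      have hcont : Continuous fun p : Matrix (Fin m) (Fin m) ℝ × Vec m =>
          WithLp.toLp 2 (p.1 *ᵥ p.2.ofLp) :=
        (PiLp.continuous_toLp 2 _).comp (Continuous.matrix_mulVec continuous_fst
          ((PiLp.continuous_ofLp 2 _).comp continuous_snd))
      have h := (hcont.tendsto _).comp ((Matrix.tendsto_inv hdet hGω).prodMk_nhds hVω)
      have h0 : WithLp.toLp 2 ((meanGram μ F)⁻¹ *ᵥ (0 : Vec m).ofLp) = 0 := by simp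
      dsimp only at h
      rw [h0] at h
      have h' := h.const_sub (θs : Vec m)
      rwa [sub_zero] at h'
    filter_upwards [hunit, hstat.eventually (mem_interior_iff_mem_nhds.1 hint)] with n hn hmem
    have h := estimator_eq_of_minimizes hF hf hexp θs hn hmem (hmω n)
    rw [h, smul_neg, ← map_smul, smul_smul]
    congr 3
    -- `√n · n⁻¹ = (√n)⁻¹` matches the scaling of the central limit theorem; it also holds at `n =
    -- 0`, where both sides are `0`.
    rw [← div_eq_mul_inv, Real.sqrt_div_self]

theorem theorem10 {d m : ℕ} (T t : ℝ) (_ht : t ∈ Set.Icc 0 T)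
    -- the true density `p(t, ·)` and the model `p_θ(t, ·)`, `θ ∈ Θ ⊆ ℝᵐ`
    (p : ℝ → Vec d → ℝ) (Θ : Set (Vec m)) (q : Θ → ℝ → Vec d → ℝ)
    (hq : ∀ θ, IsScoreDensity (q θ t))
    -- full support, well-specification and identifiability
    (_hfull : ∀ x, 0 < p t x) (θs : Θ) (hp : p t = q θs t)
    (hid : ∀ θ, θ ≠ θs → p t ≠ q θ t) :
    -- (1) consistency
    (∀ θ, JESM (p t) (score (q θ t)) = 0 ↔ θ = θs) ∧
    -- (2) asymptotic normality for exponential families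
    (∀ F : Vec d → Vec m,
      (∀ θ : Θ, ∃ c : ℝ, ∀ x, q θ t x = c * Real.exp ⟪(θ : Vec m), F x⟫) →
      (θs : Vec m) ∈ interior Θ →
      ContDiff ℝ 2 F →
      (∀ i, MemLp (fun x => gradient (fun y => F y i) x) 2 (densityLaw (p t))) →
      (∀ i, MemLp (fun x => smVector F θs x i) 2 (densityLaw (p t))) →
      IsUnit (meanGram (densityLaw (p t)) F).det ∧
      (gammaSM (densityLaw (p t)) F θs).PosSemidef ∧
      ∀ {Ω : Type*} [MeasurableSpace Ω] (P : Measure Ω) [IsProbabilityMeasure P]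
        -- i.i.d. samples from `p(t, ·)`
        (X : ℕ → Ω → Vec d), iIndepFun X P → (∀ i, HasLaw (X i) (densityLaw (p t)) P) →
        -- estimators that minimize the empirical objective over `Θ` whenever a minimizer exists
        ∀ θhat : ℕ → Ω → Θ, (∀ n, AEMeasurable (θhat n) P) →
        (∀ n, ∀ᵐ ω ∂P,
          (∃ θ₀ : Θ, ∀ θ : Θ, empiricalISM (q θ₀ t) n (fun i => X i ω) ≤
            empiricalISM (q θ t) n (fun i => X i ω)) →
          ∀ θ : Θ, empiricalISM (q (θhat n ω) t) n (fun i => X i ω) ≤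
            empiricalISM (q θ t) n (fun i => X i ω)) →
        TendstoInDistribution
          (fun (n : ℕ) ω => Real.sqrt n • ((θhat n ω : Vec m) - (θs : Vec m))) atTop
          (id : Vec m → Vec m) (fun _ => P)
          (multivariateGaussian 0 (gammaSM (densityLaw (p t)) F θs))) := by

  refine ⟨fun θ => ?_, fun F hexp hint hF hgrad hV => ?_⟩
  · rw [hp, (hq θs).JESM_score_eq_zero_iff (hq θ)]
    refine ⟨fun h => ?_, fun h => by rw [h]⟩
    by_contra hne
    exact hid θ hne (hp.trans h.symm)
  · rw [hp] at hgrad hV ⊢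
    have := (hq θs).isProbabilityMeasure
    have hinj : ∀ v : Vec m, (∀ x y, ⟪v, F x⟫ = ⟪v, F y⟫) → v = 0 := by
      intro v hv
      -- The punctured neighborhood supplies a nonzero `ε` with `θ* + εv` in `Θ`.
      have hlim : Tendsto (fun ε : ℝ => (θs : Vec m) + ε • v) (nhdsWithin 0 {0}ᶜ)
          (nhds (θs : Vec m)) := by
        have : Continuous fun ε : ℝ => (θs : Vec m) + ε • v := by fun_prop
        simpa using (this.tendsto 0).mono_left nhdsWithin_le_nhds
      obtain ⟨ε, hε, hε0⟩ := ((hlim.eventually (mem_interior_iff_mem_nhds.1 hint)).and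
        self_mem_nhdsWithin).exists
      obtain ⟨c, hc⟩ := hexp θs
      obtain ⟨c', hc'⟩ := hexp ⟨_, hε⟩
      have hc0 : c ≠ 0 := by
        rintro rfl
        simpa [hc] using (hq θs).pos 0
      -- As `v · F` is constantly `v · F(0)`, the shift by `εv` only multiplies the density by a
      -- constant.
      have heq : q ⟨_, hε⟩ t = q θs t :=
        (hq _).eq_of_eq_const_mul (hq θs) (c' * Real.exp (ε * ⟪v, F 0⟫) / c) fun x => by
          rw [hc, hc', inner_add_left, real_inner_smul_left, hv x 0, Real.exp_add]
          field_simp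
      by_contra hv0
      refine hid ⟨_, hε⟩ (fun h => ?_) (hp.trans heq.symm)
      have h' : (θs : Vec m) + ε • v = θs := congrArg Subtype.val h
      simp [hv0] at h'
      exact hε0 h'
    have hG := posDef_meanGram hF (hq θs) hgrad hinj
    refine ⟨(Matrix.isUnit_iff_isUnit_det _).1 hG.isUnit, ?_, ?_⟩
    · have h := (posSemidef_covMat hV).mul_mul_conjTranspose_same
        (meanGram (densityLaw (q θs t)) F)⁻¹
      rwa [hG.inv.isHermitian.eq] at h
    · intro Ω _ P _ X hindep hlaw θhat hmeas hmin
      exact tendstoInDistribution_scoreMatching hF hq hexp θs hint hgrad hV hG P X hindep hlaw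
        θhat hmeas hmin
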